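/- **Setting.** An agent chooses an action from a finite set $A$. Let $\underline w\in\mathbb R$, let $u:[\underline w,\infty)\to\mathbb R$ be a utility function, $c:A\to\mathbb R$ a cost function and $a^*\in A$ a target action such that: (1) $u$ is twice continuously differentiable with $u'>0$, $u''<0$ on $[\underline w,\infty)$ and $\lim_{w\to\infty}u'(w)=0$; (2) $c(A)\subseteq \operatorname{int}\big(u([\underline w,\infty))\big)$; (3) $c(a)<c(a^*)$ for some $a\in A$, and $c(a)\neq c(a^*)$ for all $a\ne a^*$. Put $A^-=\{a\in A: c(a)<c(a^*)\}$. Let $Z$ be a measurable space with a $\sigma$-finite measure $\nu$. For every $n$ and $a\in A$ let $\mu^n_a$ be a probability measure on $Z$, absolutely continuous with respect to $\nu$, with density $g^n_a$. For $a'\ne a^*$ define the log-likelihood score $L_n(a')=\frac1n\log\frac{g^n_{a^*}}{g^n_{a'}}$, and assume that for all $a,a'\in A\setminus\{a^*\}$ and $n \geq 1$ it is well-defined as a real number (i.e. $g^n_{a^*}>0$ and $g^n_{a'}>0$) $\mu^n_a$-almost surely; under $\mu^n_{a^*}$ it may also take the value $+\infty$. Assume that for all $a\in A$ and $a'\neq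 a^*$ there is a function $I_{a,a'}:\mathbb R\to[0,\infty]$ such that, for every Borel set $B\subseteq\mathbb R$, $$-\inf_{\ell\in \operatorname{int}B}I_{a,a'}(\ell)\le\liminf_{n\to\infty}\tfrac1n\log\mu^n_a[L_n(a')\in B]\le\limsup_{n\to\infty}\tfrac1n\log\mu^n_a[L_n(a')\in B]\le-\inf_{\ell\in\operatorname{cl}B}I_{a,a'}(\ell).$$ Assume further: for all $a\in A$, $a'\ne a^*$, $I_{a,a'}$ is uniquely minimized at a point $\hat L_a(a')\in\mathbb R$, and $\hat L_a(a')\neq\hat L_{b}(a')$ whenever $a\ne b$; each level set $\{\ell:I_{a,a'}(\ell)\le k\}$, $k\in\mathbb R_+$, is compact; and $I_{a^*,a'}$ is continuous at $\hat L_{a'}(a')$ and at $\hat L_{a^*}(a')$. The second-best cost $C^{\rm SB}_n$ is the infimum of $\int w\,d\mu^n_{a^*}$ over all measurable wage schemes $w:Z\to[\underline w,\infty)$ with $$\int u(w)\,d\mu^n_{a^*}-c(a^*)\ge\int u(w)\,d\mu^n_{a}-c(a)\quad\forall a\in A,\qquad \int u(w)\,d\mu^n_{a^*}-c(a^*)\ge0,$$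 and $C^{\rm bin}_n$ is the same infimum over those $w$ that in addition are binary, i.e. satisfy $|w(Z)|=2$. (An infimum over the empty set is $+\infty$.) The first-best cost $C^{\rm FB}$ is the minimal cost $W(a^*)$ over $W:A\to[\underline w,\infty)$ with $u(W(a^*))-c(a^*)\ge u(W(a))-c(a)$ for all $a\in A$ and $u(W(a^*))-c(a^*)\ge0$ (perfect monitoring); it equals $u^{-1}(c(a^*))$. **Theorem.** Let $\rho(\mu)=\min_{a\in A^-}I_{a^*,a}(\hat L_a(a))$. Then $0<\rho(\mu)<\infty$, for all large $n$ both $C^{\rm SB}_n$ and $C^{\rm bin}_n$ are finite, and, as $n\to\infty$, $$C^{\rm SB}_n-C^{\rm FB}=\exp[-\rho(\mu)n+o(n)],\qquad C^{\rm bin}_n-C^{\rm FB}=\exp[-\rho(\mu)n+o(n)].$$ -/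

import Mathlib

open MeasureTheory Filter Topology Set
open scoped ENNReal NNReal

noncomputable section

namespace Monitoring

/-- The assumptions on the payoffs. The utility of money `u` matters only on `[w₀, ∞)`; it is
twice continuously differentiable there (one-sidedly at `w₀`), strictly increasing, strictly
concave, with marginal utility tending to `0`; every effort cost `c a` is interior to the range of
utilities; the target action `aStar` is not the cheapest action, and no other action has the same
cost. -/
structure PayoffAssumptions {A : Type*} (w₀ : ℝ) (u : ℝ → ℝ) (c : A → ℝ) (aStar : A) :
    Prop where
  contDiffOn : ContDiffOn ℝ 2 u (Ici w₀)
  deriv_pos : ∀ w ∈ Ici w₀, 0 < derivWithin u (Ici w₀) w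
  deriv2_neg : ∀ w ∈ Ici w₀, iteratedDerivWithin 2 u (Ici w₀) w < 0
  deriv_tendsto : Tendsto (derivWithin u (Ici w₀)) atTop (𝓝 0)
  cost_mem : ∀ a, c a ∈ interior (u '' Ici w₀)
  exists_cheaper : ∃ a, c a < c aStar
  cost_ne : ∀ a, a ≠ aStar → c a ≠ c aStar

/-- The first-best cost: the minimal cost of implementing `aStar` under perfect monitoring, where
the wage `W a` may depend on the chosen action `a` itself. -/
def firstBestCost {A : Type*} (w₀ : ℝ) (u : ℝ → ℝ) (c : A → ℝ) (aStar : A) : ℝ :=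
  sInf {k : ℝ | ∃ W : A → ℝ, (∀ a, w₀ ≤ W a) ∧
    (∀ a, u (W a) - c a ≤ u (W aStar) - c aStar) ∧ 0 ≤ u (W aStar) - c aStar ∧ k = W aStar}

section Contracts

variable {A Z : Type*} [MeasurableSpace Z]

/-- `w` is a wage scheme with values in `[w₀, ∞)` of finite expected cost under `aStar` that
satisfies incentive compatibility and individual rationality when the signal has law `P a` under
action `a`. (Since `u` is concave and `w` is bounded below, a scheme of finite expected cost has
finite expected utility under `aStar`; if `u ∘ w` is not integrable under another action `a`, its
expectation there is `+∞` and incentive compatibility fails.) -/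
structure IsFeasible (P : A → Measure Z) (w₀ : ℝ) (u : ℝ → ℝ) (c : A → ℝ) (aStar : A)
    (w : Z → ℝ) : Prop where
  measurable : Measurable w
  lower_bound : ∀ z, w₀ ≤ w z
  integrable_wage : Integrable w (P aStar)
  integrable_utility : ∀ a, Integrable (fun z => u (w z)) (P a)
  incentive_compatible : ∀ a,
    (∫ z, u (w z) ∂(P a)) - c a ≤ (∫ z, u (w z) ∂(P aStar)) - c aStar
  individually_rational : 0 ≤ (∫ z, u (w z) ∂(P aStar)) - c aStar

/-- A binary wage scheme takes exactly two values. -/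
def IsBinary (w : Z → ℝ) : Prop := (range w).ncard = 2

/-- The second-best cost, an infimum in the extended reals (`⊤` if nothing is feasible). -/
def secondBestCost (P : A → Measure Z) (w₀ : ℝ) (u : ℝ → ℝ) (c : A → ℝ) (aStar : A) : EReal :=
  ⨅ (w : Z → ℝ) (_ : IsFeasible P w₀ u c aStar w), ((∫ z, w z ∂(P aStar) : ℝ) : EReal)

/-- The second-best cost when the principal is restricted to binary wage schemes. -/
def binaryCost (P : A → Measure Z) (w₀ : ℝ) (u : ℝ → ℝ) (c : A → ℝ) (aStar : A) : EReal :=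
  ⨅ (w : Z → ℝ) (_ : IsFeasible P w₀ u c aStar w ∧ IsBinary w),
    ((∫ z, w z ∂(P aStar) : ℝ) : EReal)

end Contracts

section Scores

variable {A Z : Type*} [MeasurableSpace Z]

/-- The density of the signal distribution of action `a` in the `n`-th monitoring technology. -/
def density (ν : Measure Z) (μ : ℕ → A → Measure Z) (n : ℕ) (a : A) : Z → ℝ≥0∞ :=
  (μ n a).rnDeriv ν

/-- The log-likelihood score `L_n(a') = (1/n) log (g^n_{aStar} / g^n_{a'})`, as an extended real.
It is a real number wherever both densities are positive and finite, and it is `+∞` where the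
density of `aStar` is positive and that of `a'` is zero. -/
def score (ν : Measure Z) (μ : ℕ → A → Measure Z) (aStar : A) (n : ℕ) (a' : A) (z : Z) : EReal :=
  (((n : ℝ)⁻¹ : ℝ) : EReal) * ENNReal.log (density ν μ n aStar z / density ν μ n a' z)

/-- For all `a, a' ≠ aStar` the score `L_n(a')` is well-defined (as a real number) almost surely
when the chosen action is `a`. -/
def ScoresWellDefined (ν : Measure Z) (μ : ℕ → A → Measure Z) (aStar : A) : Prop :=
  ∀ n : ℕ, 1 ≤ n → ∀ a a' : A, a ≠ aStar → a' ≠ aStar →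
    ∀ᵐ z ∂(μ n a), 0 < density ν μ n aStar z ∧ 0 < density ν μ n a' z

/-- The large-deviation principle, at speed `n` and with rate function `I`, for the laws on `ℝ` of
random variables `X n` defined on the probability spaces `(Z, P n)`. -/
def LargeDeviationPrinciple (P : ℕ → Measure Z) (X : ℕ → Z → EReal) (I : ℝ → ℝ≥0∞) : Prop :=
  ∀ B : Set ℝ, MeasurableSet B →
    -(⨅ ℓ ∈ interior B, (I ℓ : EReal)) ≤
      liminf (fun n : ℕ => (((n : ℝ)⁻¹ : ℝ) : EReal) *
        ENNReal.log (P n {z | ∃ ℓ ∈ B, X n z = (ℓ : EReal)})) atTop ∧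
    limsup (fun n : ℕ => (((n : ℝ)⁻¹ : ℝ) : EReal) *
        ENNReal.log (P n {z | ∃ ℓ ∈ B, X n z = (ℓ : EReal)})) atTop ≤
      -(⨅ ℓ ∈ closure B, (I ℓ : EReal))

end Scores

/-- The rate `min I_{aStar,a}(L̂_a(a))` over the finitely many actions `a` that are cheaper than
`aStar`. The first index of `I` and of `Lhat` is the chosen action, the second one the score. -/
def rate {A : Type*} (c : A → ℝ) (aStar : A) (I : A → A → ℝ → ℝ≥0∞) (Lhat : A → A → ℝ) : ℝ≥0∞ :=
  ⨅ (a : A) (_ : c a < c aStar), I aStar a (Lhat a a)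

/-- `C n - C₀ = exp (-ρ n + o(n))` as `n → ∞`; in particular `C n` is finite for large `n`. -/
def ConvergesAtRate (C : ℕ → EReal) (C₀ : ℝ) (ρ : ℝ) : Prop :=
  ∃ r : ℕ → ℝ, r =o[atTop] (fun n : ℕ => (n : ℝ)) ∧
    ∀ᶠ n : ℕ in atTop, C n = ((C₀ + Real.exp (-ρ * n + r n) : ℝ) : EReal)

end Monitoring

end

/-! On an event where the score of `a` is close to `x`, the density of the law of `aStar` with
respect to that of `a` is about `exp (n * x)`. Under a cheaper action `a` the score of `a`
concentrates at `Lhat a a`, so an event of non-vanishing probability under `a` has probability at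
least about `exp (n * Lhat a a)` under `aStar`, while the event that this score lies below about
`Lhat a a` has at most that probability under `aStar`. Comparison with the large-deviation principle
identifies `I aStar a (Lhat a a)` as `-Lhat a a`.

Lower bound: deterring `a` requires low wages on an event that is not rare under `a`, unless
expected utility, and hence cost, is too high anyway (`exists_low_wage_event`). By strict concavity
the excess over first best is at least a multiple of the probability of that event under `aStar`.

Upper bound: pay the minimum wage when the score of some cheaper action is low, and otherwise
slightly more than the first-best wage. The excess cost is at most a multiple of the punishment
probability under `aStar` (`exists_binaryCost_le`). The two bounds meet at the rate, for binary and
general contracts alike. -/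

namespace Monitoring

/-! ### Utility: monotonicity, tangent lines, local inverse, and the first-best cost. -/

namespace PayoffAssumptions

variable {A : Type*} {w₀ : ℝ} {u : ℝ → ℝ} {c : A → ℝ} {aStar : A}

theorem deriv_eq_derivWithin {f : ℝ → ℝ} {w : ℝ} (hw : w₀ < w) :
    deriv f w = derivWithin f (Ici w₀) w :=
  (derivWithin_of_mem_nhds (Ici_mem_nhds hw)).symm

theorem strictMonoOn (h : PayoffAssumptions w₀ u c aStar) : StrictMonoOn u (Ici w₀) := by
  refine strictMonoOn_of_deriv_pos (convex_Ici w₀) h.contDiffOn.continuousOn fun x hx => ?_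
  rw [interior_Ici, mem_Ioi] at hx
  rw [deriv_eq_derivWithin hx]
  exact h.deriv_pos x hx.le

theorem strictAntiOn_derivWithin (h : PayoffAssumptions w₀ u c aStar) :
    StrictAntiOn (derivWithin u (Ici w₀)) (Ici w₀) := by
  refine strictAntiOn_of_deriv_neg (convex_Ici w₀)
    (h.contDiffOn.continuousOn_derivWithin (uniqueDiffOn_Ici w₀) (by norm_num)) fun x hx => ?_
  rw [interior_Ici, mem_Ioi] at hx
  have := h.deriv2_neg x hx.le
  rwa [iteratedDerivWithin_succ, iteratedDerivWithin_one, ← deriv_eq_derivWithin hx] at this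

theorem hasDerivAt (h : PayoffAssumptions w₀ u c aStar) {w : ℝ} (hw : w₀ < w) :
    HasDerivAt u (derivWithin u (Ici w₀) w) w := by
  have hd : DifferentiableWithinAt ℝ u (Ici w₀) w :=
    h.contDiffOn.differentiableOn (by norm_num) w hw.le
  exact hd.hasDerivWithinAt.hasDerivAt (Ici_mem_nhds hw)

theorem utility_lower_bound_lt (h : PayoffAssumptions w₀ u c aStar) (a : A) : u w₀ < c a := by
  have hsub : u '' Ici w₀ ⊆ Ici (u w₀) := by
    rintro _ ⟨w, hw, rfl⟩
    exact h.strictMonoOn.monotoneOn self_mem_Ici hw hw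
  have := interior_mono hsub (h.cost_mem a)
  rwa [interior_Ici] at this

theorem exists_wage (h : PayoffAssumptions w₀ u c aStar) : ∃ w, w₀ < w ∧ u w = c aStar := by
  obtain ⟨w, hw, hu⟩ := interior_subset (h.cost_mem aStar)
  refine ⟨w, lt_of_le_of_ne hw ?_, hu⟩
  rintro rfl
  exact (h.utility_lower_bound_lt aStar).ne hu

theorem firstBestCost_eq (h : PayoffAssumptions w₀ u c aStar) {w : ℝ} (hw : w₀ < w)
    (hu : u w = c aStar) : firstBestCost w₀ u c aStar = w := by
  classical
  refine IsLeast.csInf_eq ⟨?_, ?_⟩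
  · refine ⟨fun a => if a = aStar then w else w₀, fun a => ?_, fun a => ?_, ?_, ?_⟩
    · dsimp only; split_ifs
      exacts [hw.le, le_rfl]
    · by_cases ha : a = aStar
      · simp [ha]
      · have := h.utility_lower_bound_lt a
        simp only [ha, if_false, if_true]
        linarith
    · simp [hu]
    · simp
  · rintro k ⟨W, hW, -, hIR, rfl⟩
    exact (h.strictMonoOn.le_iff_le hw.le (hW _)).1 (by linarith)

/-- The tangent at `w` minus `u` vanishes at `w` and, since `u'` is strictly decreasing, falls
before `w` and rises after it. Its value at `v` is thus a uniform gap for all wages up to `v`: the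
price of risk in the lower bound. -/
theorem exists_tangent_gap (h : PayoffAssumptions w₀ u c aStar) {w v : ℝ} (hv : w₀ ≤ v)
    (hvw : v < w) : ∃ s > 0, ∃ γ > 0, (∀ x ≥ w₀, u x ≤ u w + s * (x - w)) ∧
      ∀ x ≥ w₀, x ≤ v → u x + γ ≤ u w + s * (x - w) := by
  have hw : w₀ < w := hv.trans_lt hvw
  set s := derivWithin u (Ici w₀) w with hs
  set φ : ℝ → ℝ := fun x => u w + s * (x - w) - u x with hφ
  have hcont : ContinuousOn φ (Ici w₀) :=
    (Continuous.continuousOn (by fun_prop)).sub h.contDiffOn.continuousOn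
  have hder : ∀ x, w₀ < x → deriv φ x = s - derivWithin u (Ici w₀) x := fun x hx => by
    have := ((((hasDerivAt_id x).sub_const w).const_mul s).const_add (u w)).sub (h.hasDerivAt hx)
    simpa using (this.congr_of_eventuallyEq (EventuallyEq.refl _ φ)).deriv
  have hanti : StrictAntiOn φ (Icc w₀ w) := by
    refine strictAntiOn_of_deriv_neg (convex_Icc _ _) (hcont.mono Icc_subset_Ici_self)
      fun x hx => ?_
    rw [interior_Icc] at hx
    rw [hder x hx.1]
    have := h.strictAntiOn_derivWithin (mem_Ici.2 hx.1.le) (mem_Ici.2 hw.le) hx.2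
    linarith
  have hmono : StrictMonoOn φ (Ici w) := by
    refine strictMonoOn_of_deriv_pos (convex_Ici _) (hcont.mono (Ici_subset_Ici.2 hw.le))
      fun x hx => ?_
    rw [interior_Ici, mem_Ioi] at hx
    rw [hder x (hw.trans hx)]
    have := h.strictAntiOn_derivWithin (mem_Ici.2 hw.le) (mem_Ici.2 (hw.trans hx).le) hx
    linarith
  have hzero : φ w = 0 := by simp [hφ]
  refine ⟨s, h.deriv_pos w hw.le, φ v, ?_, fun x hx => ?_, fun x hx hxv => ?_⟩
  · have := hanti ⟨hv, hvw.le⟩ ⟨hw.le, le_rfl⟩ hvw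
    simpa [hzero] using this
  · have : 0 ≤ φ x := by
      rw [← hzero]
      rcases le_total x w with hxw | hxw
      · exact hanti.antitoneOn ⟨hx, hxw⟩ ⟨hw.le, le_rfl⟩ hxw
      · exact hmono.monotoneOn self_mem_Ici hxw hxw
    simp only [hφ] at this
    linarith
  · have := hanti.antitoneOn ⟨hx, hxv.trans hvw.le⟩ ⟨hv, hvw.le⟩ hxv
    simp only [hφ] at this ⊢
    linarith

/-- On `[w, w + 1]` the slope of `u` is at least its slope at `w + 1`, so by the mean value theorem
the inverse has Lipschitz constant the reciprocal of that slope. Small utility bonuses therefore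
cost linearly little. -/
theorem exists_lipschitz_inverse (h : PayoffAssumptions w₀ u c aStar) {w : ℝ} (hw : w₀ < w) :
    ∃ K > 0, ∃ δ > 0, ∀ v ∈ Icc (u w) (u w + δ), ∃ x ≥ w, u x = v ∧ x - w ≤ K * (v - u w) := by
  have hw1 : w₀ < w + 1 := by linarith
  have hg : 0 < derivWithin u (Ici w₀) (w + 1) := h.deriv_pos _ hw1.le
  have hlt : u w < u (w + 1) := h.strictMonoOn hw.le hw1.le (by linarith)
  refine ⟨(derivWithin u (Ici w₀) (w + 1))⁻¹, inv_pos.2 hg, u (w + 1) - u w, by linarith,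
    fun v hv => ?_⟩
  have hcont : ContinuousOn u (Icc w (w + 1)) :=
    h.contDiffOn.continuousOn.mono fun x hx => hw.le.trans hx.1
  obtain ⟨x, hx, hxv⟩ := intermediate_value_Icc (by linarith) hcont
    (show v ∈ Icc (u w) (u (w + 1)) from ⟨hv.1, by linarith [hv.2]⟩)
  refine ⟨x, hx.1, hxv, ?_⟩
  rcases hx.1.eq_or_lt with rfl | hlt'
  · simp [← hxv]
  obtain ⟨y, hy, hslope⟩ := exists_hasDerivAt_eq_slope u (derivWithin u (Ici w₀)) hlt'
    (hcont.mono (Icc_subset_Icc_right hx.2))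
    fun y hy => h.hasDerivAt (hw.trans hy.1)
  have hge : derivWithin u (Ici w₀) (w + 1) ≤ derivWithin u (Ici w₀) y :=
    h.strictAntiOn_derivWithin.antitoneOn (mem_Ici.2 (hw.trans hy.1).le) (mem_Ici.2 hw1.le)
      (hy.2.le.trans hx.2)
  rw [hslope, le_div_iff₀ (by linarith), hxv] at hge
  rw [inv_mul_eq_div, le_div_iff₀ hg]
  linarith

end PayoffAssumptions

end Monitoring

/-! ### Scores as likelihood ratios: change of measure. -/

namespace Monitoring

theorem inv_mul_log_le_iff {n : ℕ} (hn : 1 ≤ n) (x : ℝ≥0∞) (t : ℝ) :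
    (((n : ℝ)⁻¹ : ℝ) : EReal) * ENNReal.log x ≤ (t : EReal) ↔
      x ≤ ENNReal.ofReal (Real.exp (n * t)) := by
  have hn' : (0 : ℝ) < n := by exact_mod_cast hn
  rw [← ENNReal.log_rpow, ← EReal.log_exp (t : EReal), ENNReal.log_le_log_iff,
    ENNReal.rpow_inv_le_iff hn', EReal.exp_coe, ENNReal.ofReal_rpow_of_pos (Real.exp_pos t),
    ← Real.exp_mul, mul_comm t]

theorem le_inv_mul_log_iff {n : ℕ} (hn : 1 ≤ n) (x : ℝ≥0∞) (t : ℝ) :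
    (t : EReal) ≤ (((n : ℝ)⁻¹ : ℝ) : EReal) * ENNReal.log x ↔
      ENNReal.ofReal (Real.exp (n * t)) ≤ x := by
  have hn' : (0 : ℝ) < n := by exact_mod_cast hn
  rw [← ENNReal.log_rpow, ← EReal.log_exp (t : EReal), ENNReal.log_le_log_iff,
    ENNReal.le_rpow_inv_iff hn', EReal.exp_coe, ENNReal.ofReal_rpow_of_pos (Real.exp_pos t),
    ← Real.exp_mul, mul_comm t]

section Scores

variable {A Z : Type*} [MeasurableSpace Z] {ν : Measure Z} {μ : ℕ → A → Measure Z} {aStar : A}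

theorem measurable_score (n : ℕ) (a : A) : Measurable (score ν μ aStar n a) := by
  have h : Measurable fun z => density ν μ n aStar z / density ν μ n a z :=
    (Measure.measurable_rnDeriv _ _).div (Measure.measurable_rnDeriv _ _)
  exact h.ennreal_log.const_mul _

variable [∀ n a, IsProbabilityMeasure (μ n a)]

/-- The large-deviation principle sees only real values of the score; mass at infinity must be
excluded before it can control complements. -/
theorem ae_score_real (hac : ∀ n a, μ n a ≪ ν) (h : ScoresWellDefined ν μ aStar) {n : ℕ}
    (hn : 1 ≤ n) {a a' : A} (ha : a ≠ aStar) (ha' : a' ≠ aStar) :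
    ∀ᵐ z ∂(μ n a), ∃ ℓ : ℝ, score ν μ aStar n a' z = ℓ := by
  filter_upwards [h n hn a a' ha ha', (hac n a).ae_le (Measure.rnDeriv_lt_top (μ n aStar) ν),
    (hac n a).ae_le (Measure.rnDeriv_lt_top (μ n a') ν)] with z hz h1 h2
  have h0 : density ν μ n aStar z / density ν μ n a' z ≠ 0 :=
    (ENNReal.div_pos hz.1.ne' h2.ne).ne'
  have ht : density ν μ n aStar z / density ν μ n a' z ≠ ⊤ := ENNReal.div_ne_top h1.ne hz.2.ne'
  refine ⟨(n : ℝ)⁻¹ * Real.log (density ν μ n aStar z / density ν μ n a' z).toReal, ?_⟩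
  rw [score, ENNReal.log_pos_real h0 ht, EReal.coe_mul]

variable [SigmaFinite ν]

/-- The score bound is a pointwise inequality between densities, integrated over `S`. It survives
vanishing densities, since `0 / 0 = 0` in `ℝ≥0∞`. -/
theorem measure_le_of_score_le (hac : ∀ n a, μ n a ≪ ν) {n : ℕ} (hn : 1 ≤ n) (a : A) {t : ℝ}
    {S : Set Z} (hS : MeasurableSet S) (h : ∀ z ∈ S, score ν μ aStar n a z ≤ t) :
    (μ n aStar).real S ≤ Real.exp (n * t) * (μ n a).real S := by
  have key : μ n aStar S ≤ ENNReal.ofReal (Real.exp (n * t)) * μ n a S := by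
    rw [← Measure.setLIntegral_rnDeriv (hac n aStar), ← Measure.setLIntegral_rnDeriv (hac n a),
      ← lintegral_const_mul _ (Measure.measurable_rnDeriv _ _)]
    refine setLIntegral_mono' hS fun z hz => ?_
    have := (inv_mul_log_le_iff hn _ t).1 (h z hz)
    rwa [ENNReal.div_le_iff_le_mul (Or.inr ENNReal.ofReal_ne_top)
      (Or.inr (by simp [Real.exp_pos]))] at this
  have := ENNReal.toReal_mono (ENNReal.mul_ne_top ENNReal.ofReal_ne_top (measure_ne_top _ _)) key
  rwa [ENNReal.toReal_mul, ENNReal.toReal_ofReal (Real.exp_pos _).le] at this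

theorem le_measure_of_le_score (hac : ∀ n a, μ n a ≪ ν) {n : ℕ} (hn : 1 ≤ n) (a : A) {t : ℝ}
    {S : Set Z} (hS : MeasurableSet S) (h : ∀ z ∈ S, t ≤ score ν μ aStar n a z) :
    Real.exp (n * t) * (μ n a).real S ≤ (μ n aStar).real S := by
  have key : ENNReal.ofReal (Real.exp (n * t)) * μ n a S ≤ μ n aStar S := by
    rw [← Measure.setLIntegral_rnDeriv (hac n aStar), ← Measure.setLIntegral_rnDeriv (hac n a),
      ← lintegral_const_mul _ (Measure.measurable_rnDeriv _ _)]
    refine setLIntegral_mono' hS fun z hz => ?_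
    have := (le_inv_mul_log_iff hn _ t).1 (h z hz)
    exact ENNReal.mul_le_of_le_div this
  have := ENNReal.toReal_mono (measure_ne_top _ _) key
  rwa [ENNReal.toReal_mul, ENNReal.toReal_ofReal (Real.exp_pos _).le] at this

end Scores

/-! ### Large-deviation bounds in exponential form, and their converses for the rate function. -/

namespace LargeDeviationPrinciple

variable {Z : Type*} [MeasurableSpace Z] {P : ℕ → Measure Z} {X : ℕ → Z → EReal} {I : ℝ → ℝ≥0∞}

theorem eventually_le (h : LargeDeviationPrinciple P X I) {B : Set ℝ} (hB : IsClosed B) {t : ℝ}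
    (ht : ∀ ℓ ∈ B, ENNReal.ofReal t ≤ I ℓ) {s : ℝ} (hs : s < t) :
    ∀ᶠ n : ℕ in atTop, P n {z | ∃ ℓ ∈ B, X n z = (ℓ : EReal)} ≤
      ENNReal.ofReal (Real.exp (-(n * s))) := by
  have hle := (h B hB.measurableSet).2
  rw [hB.closure_eq] at hle
  have hinf : (t : EReal) ≤ ⨅ ℓ ∈ B, (I ℓ : EReal) := by
    refine le_iInf₂ fun ℓ hℓ => ?_
    have := EReal.coe_ennreal_le_coe_ennreal_iff.2 (ht ℓ hℓ)
    rw [EReal.coe_ennreal_ofReal] at this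
    exact (EReal.coe_le_coe_iff.2 (le_max_left t 0)).trans this
  have hlt : -(⨅ ℓ ∈ B, (I ℓ : EReal)) < ((-s : ℝ) : EReal) := by
    refine (EReal.neg_le_neg_iff.2 hinf).trans_lt ?_
    rw [← EReal.coe_neg]
    exact_mod_cast neg_lt_neg hs
  filter_upwards [Filter.eventually_lt_of_limsup_lt (hle.trans_lt hlt), eventually_ge_atTop 1]
    with n hn hn1
  have := (inv_mul_log_le_iff hn1 _ _).1 hn.le
  rwa [mul_neg] at this

theorem exists_rate_le (h : LargeDeviationPrinciple P X I) {B : Set ℝ} (hB : IsClosed B) {t s : ℝ}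
    (ht : ∃ᶠ n : ℕ in atTop, ENNReal.ofReal (Real.exp (-(n * t))) ≤
      P n {z | ∃ ℓ ∈ B, X n z = (ℓ : EReal)}) (hs : t < s) :
    ∃ ℓ ∈ B, I ℓ ≤ ENNReal.ofReal s := by
  by_contra! hcon
  obtain ⟨r, htr, hrs⟩ := exists_between hs
  obtain ⟨n, hn, hn1, hle⟩ := (ht.and_eventually
    ((eventually_ge_atTop 1).and (h.eventually_le hB (fun ℓ hℓ => (hcon ℓ hℓ).le) hrs))).exists
  have := hn.trans hle
  rw [ENNReal.ofReal_le_ofReal_iff (Real.exp_pos _).le, Real.exp_le_exp, neg_le_neg_iff] at this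
  have hn' : (0 : ℝ) < n := by exact_mod_cast hn1
  exact absurd (le_of_mul_le_mul_left this hn') (not_le.2 htr)

theorem le_rate (h : LargeDeviationPrinciple P X I) {B : Set ℝ} (hB : IsOpen B) {t : ℝ}
    (ht : ∀ᶠ n : ℕ in atTop, P n {z | ∃ ℓ ∈ B, X n z = (ℓ : EReal)} ≤
      ENNReal.ofReal (Real.exp (-(n * t)))) {ℓ : ℝ} (hℓ : ℓ ∈ B) :
    ENNReal.ofReal t ≤ I ℓ := by
  have hge := (h B hB.measurableSet).1
  rw [hB.interior_eq] at hge
  have hlim : liminf (fun n : ℕ => (((n : ℝ)⁻¹ : ℝ) : EReal) *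
        ENNReal.log (P n {z | ∃ ℓ ∈ B, X n z = (ℓ : EReal)})) atTop ≤ ((-t : ℝ) : EReal) := by
    refine liminf_le_of_frequently_le' (Eventually.frequently ?_)
    filter_upwards [ht, eventually_ge_atTop 1] with n hn hn1
    rw [inv_mul_log_le_iff hn1, mul_neg]
    exact hn
  have h1 : (t : EReal) ≤ I ℓ := by
    have := hge.trans hlim
    rw [EReal.coe_neg, EReal.neg_le_neg_iff] at this
    exact this.trans (iInf₂_le ℓ hℓ)
  rw [← EReal.coe_ennreal_le_coe_ennreal_iff, EReal.coe_ennreal_ofReal]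
  exact max_le h1 (EReal.coe_ennreal_nonneg _)

end LargeDeviationPrinciple

end Monitoring

/-! ### Concentration of scores and the value of the rate function. -/

namespace Monitoring

/-- Compact level sets make `I` lower semicontinuous, so it attains its minimum on `F ∩ {I ≤ 1}`;
elsewhere on `F` it exceeds 1. -/
theorem exists_pos_le_of_isClosed {I : ℝ → ℝ≥0∞} (hI : ∀ k : ℝ≥0, IsCompact {ℓ : ℝ | I ℓ ≤ k})
    {F : Set ℝ} (hF : IsClosed F) (hpos : ∀ ℓ ∈ F, 0 < I ℓ) :
    ∃ t > 0, ∀ ℓ ∈ F, ENNReal.ofReal t ≤ I ℓ := by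
  have hlsc : LowerSemicontinuous I := by
    rw [lowerSemicontinuous_iff_isClosed_preimage]
    intro y
    induction y with
    | top => simp
    | coe k => exact (hI k).isClosed
  rcases (F ∩ {ℓ | I ℓ ≤ (1 : ℝ≥0)}).eq_empty_or_nonempty with he | hne
  · refine ⟨1, one_pos, fun ℓ hℓ => ?_⟩
    by_contra! hlt
    have : ℓ ∈ F ∩ {ℓ | I ℓ ≤ (1 : ℝ≥0)} := ⟨hℓ, by simpa using hlt.le⟩
    rw [he] at this
    exact this
  · obtain ⟨y, hy, hmin⟩ := LowerSemicontinuousOn.exists_isMinOn hne ((hI 1).inter_left hF)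
      (hlsc.lowerSemicontinuousOn _)
    have hytop : I y ≠ ⊤ := ne_top_of_le_ne_top ENNReal.coe_ne_top hy.2
    refine ⟨(I y).toReal, ENNReal.toReal_pos (hpos y hy.1).ne' hytop, fun ℓ hℓ => ?_⟩
    rw [ENNReal.ofReal_toReal hytop]
    rcases le_total (I ℓ) (1 : ℝ≥0) with h1 | h1
    · exact hmin ⟨hℓ, h1⟩
    · exact le_trans hy.2 h1

theorem eventually_exp_neg_mul_le {a η : ℝ} (ha : 0 < a) (hη : 0 < η) :
    ∀ᶠ n : ℕ in atTop, Real.exp (-(n * a)) ≤ η := by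
  have h : Tendsto (fun n : ℕ => Real.exp (-(n * a))) atTop (𝓝 0) :=
    Real.tendsto_exp_neg_atTop_nhds_zero.comp
      (tendsto_natCast_atTop_atTop.atTop_mul_const ha)
  exact (h.eventually_lt_const hη).mono fun n hn => hn.le

theorem exists_real_of_mem_Icc {x : EReal} {a b : ℝ} (ha : (a : EReal) ≤ x) (hb : x ≤ b) :
    ∃ ℓ ∈ Icc a b, x = ((ℓ : ℝ) : EReal) := by
  induction x with
  | bot => simp at ha
  | top => simp at hb
  | coe x => exact ⟨x, ⟨EReal.coe_le_coe_iff.1 ha, EReal.coe_le_coe_iff.1 hb⟩, rfl⟩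

namespace LargeDeviationPrinciple

variable {Z : Type*} [MeasurableSpace Z] {P : ℕ → Measure Z}
  {X : ℕ → Z → EReal} {I : ℝ → ℝ≥0∞} {x₀ : ℝ}

/-- Away from the unique minimizer the rate is bounded below by a positive constant, so the mass
there decays exponentially. -/
theorem eventually_concentrated (h : LargeDeviationPrinciple P X I)
    (hX : ∀ n : ℕ, 1 ≤ n → ∀ᵐ z ∂(P n), ∃ ℓ : ℝ, X n z = ℓ)
    (hcompact : ∀ k : ℝ≥0, IsCompact {ℓ : ℝ | I ℓ ≤ k})
    (hmin : ∀ ℓ, ℓ ≠ x₀ → I x₀ < I ℓ) {ε η : ℝ} (hε : 0 < ε) (hη : 0 < η) :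
    ∀ᶠ n : ℕ in atTop, (P n).real
      {z | ((x₀ - ε : ℝ) : EReal) ≤ X n z ∧ X n z ≤ ((x₀ + ε : ℝ) : EReal)}ᶜ ≤ η := by
  have hF : IsClosed (Ioo (x₀ - ε) (x₀ + ε))ᶜ := isOpen_Ioo.isClosed_compl
  obtain ⟨t, ht, hI⟩ := exists_pos_le_of_isClosed hcompact hF fun ℓ hℓ =>
    (zero_le).trans_lt (hmin ℓ (by
      rintro rfl
      exact hℓ ⟨by linarith, by linarith⟩))
  filter_upwards [h.eventually_le hF hI (half_lt_self ht),
    eventually_exp_neg_mul_le (half_pos ht) hη, eventually_ge_atTop 1] with n hn hη hn1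
  refine le_trans ?_ hη
  rw [measureReal_def]
  refine ENNReal.toReal_le_of_le_ofReal (Real.exp_pos _).le (le_trans (measure_mono_ae ?_) hn)
  filter_upwards [hX n hn1] with z ⟨ℓ, hℓ⟩ hz
  refine ⟨ℓ, fun hmem => hz ?_, hℓ⟩
  rw [mem_ofPred_eq, hℓ]
  exact ⟨by exact_mod_cast hmem.1.le, by exact_mod_cast hmem.2.le⟩

end LargeDeviationPrinciple

section Rate

variable {A Z : Type*} [MeasurableSpace Z] {ν : Measure Z} [SigmaFinite ν] {μ : ℕ → A → Measure Z}
  [∀ n a, IsProbabilityMeasure (μ n a)] {aStar a : A} {x₀ : ℝ} {I : ℝ → ℝ≥0∞}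

/-- A window around `x₀` has mass at least 1/2 under `a`, hence at least about `exp (n * x₀)` under
`aStar`. The large-deviation upper bound then yields a point of the window with small rate;
continuity carries this to `x₀` itself. -/
theorem rate_le_neg_of_concentrated (hac : ∀ n a, μ n a ≪ ν)
    (hldp : LargeDeviationPrinciple (fun n => μ n aStar) (fun n => score ν μ aStar n a) I)
    (hconc : ∀ ε > 0, ∀ η > 0, ∀ᶠ n : ℕ in atTop, (μ n a).real
      {z | ((x₀ - ε : ℝ) : EReal) ≤ score ν μ aStar n a z ∧
        score ν μ aStar n a z ≤ ((x₀ + ε : ℝ) : EReal)}ᶜ ≤ η)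
    (hcont : ContinuousAt I x₀) : I x₀ ≤ ENNReal.ofReal (-x₀) := by
  by_contra! hlt
  obtain ⟨q, hq1, hq2⟩ := exists_between hlt
  -- One `ε` pays for the width of the window, one absorbs the factor 1/2, one is the strict slack
  -- in `exists_rate_le`.
  have h1 : ∀ᶠ ε in 𝓝 (0 : ℝ), ENNReal.ofReal (-x₀ + 3 * ε) < q := by
    have : Tendsto (fun ε : ℝ => ENNReal.ofReal (-x₀ + 3 * ε)) (𝓝 0)
        (𝓝 (ENNReal.ofReal (-x₀ + 3 * 0))) :=
      (ENNReal.continuous_ofReal.comp (by fun_prop)).tendsto _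
    rw [mul_zero, add_zero] at this
    exact this.eventually_lt_const hq1
  obtain ⟨δ, hδ, hball⟩ := Metric.eventually_nhds_iff.1 (hcont.tendsto.eventually_const_lt hq2)
  obtain ⟨δ', hδ', hball'⟩ := Metric.eventually_nhds_iff.1 h1
  obtain ⟨ε, hε, hεm⟩ := exists_between (lt_min hδ hδ')
  have hεq := hball' (y := ε) (by
    rw [Real.dist_eq, sub_zero, abs_of_pos hε]; exact hεm.trans_le (min_le_right _ _))
  have hev : ∀ᶠ n : ℕ in atTop, ENNReal.ofReal (Real.exp (-(n * (-x₀ + 2 * ε)))) ≤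
      μ n aStar {z | ∃ ℓ ∈ Icc (x₀ - ε) (x₀ + ε), score ν μ aStar n a z = ((ℓ : ℝ) : EReal)} := by
    filter_upwards [hconc ε hε (1 / 2) (by norm_num), eventually_ge_atTop 1,
      eventually_exp_neg_mul_le hε (one_half_pos (α := ℝ))] with n hn hn1 hexp
    set S := {z | ((x₀ - ε : ℝ) : EReal) ≤ score ν μ aStar n a z ∧
        score ν μ aStar n a z ≤ ((x₀ + ε : ℝ) : EReal)} with hS
    have hSm : MeasurableSet S :=
      (measurableSet_le measurable_const (measurable_score n a)).inter
        (measurableSet_le (measurable_score n a) measurable_const)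
    have hQ : 1 / 2 ≤ (μ n a).real S := by
      rw [probReal_compl_eq_one_sub hSm] at hn; linarith
    have hP := le_measure_of_le_score hac hn1 a hSm (t := x₀ - ε) fun z hz => hz.1
    refine le_trans (ENNReal.ofReal_le_of_le_toReal ?_)
      (measure_mono fun z hz => exists_real_of_mem_Icc hz.1 hz.2 : μ n aStar S ≤ _)
    refine le_trans ?_ hP
    have : Real.exp (-(n * (-x₀ + 2 * ε))) = Real.exp (n * (x₀ - ε)) * Real.exp (-(n * ε)) := by
      rw [← Real.exp_add]; ring_nf
    rw [this]
    exact mul_le_mul_of_nonneg_left (hexp.trans hQ) (Real.exp_pos _).le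
  obtain ⟨ℓ, hℓ, hIℓ⟩ := hldp.exists_rate_le isClosed_Icc hev.frequently
    (show -x₀ + 2 * ε < -x₀ + 3 * ε by linarith)
  have hd : dist ℓ x₀ < δ := by
    refine lt_of_le_of_lt ?_ (hεm.trans_le (min_le_left _ _))
    rw [Real.dist_eq, abs_le]
    constructor <;> linarith [hℓ.1, hℓ.2]
  exact absurd (hIℓ.trans_lt hεq) (not_lt.2 (hball hd).le)

/-- No concentration is needed: a score below `t` has probability at most `exp (n * t)` under
`aStar`. The large-deviation lower bound on a half-line containing `x₀` gives the claim as `ε` tends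
to 0. -/
theorem neg_le_rate (hac : ∀ n a, μ n a ≪ ν)
    (hldp : LargeDeviationPrinciple (fun n => μ n aStar) (fun n => score ν μ aStar n a) I)
    (x₀ : ℝ) : ENNReal.ofReal (-x₀) ≤ I x₀ := by
  have hε : ∀ ε : ℝ, 0 < ε → ENNReal.ofReal (-x₀ - ε) ≤ I x₀ := by
    intro ε hε
    refine hldp.le_rate (isOpen_Iio (a := x₀ + ε)) ?_ (by simpa using hε)
    filter_upwards [eventually_ge_atTop 1] with n hn
    set S := {z | score ν μ aStar n a z ≤ ((x₀ + ε : ℝ) : EReal)} with hS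
    have hSm : MeasurableSet S := measurableSet_le (measurable_score n a) measurable_const
    have hP := measure_le_of_score_le hac hn a hSm (t := x₀ + ε) fun z hz => hz
    have hsub : {z | ∃ ℓ ∈ Iio (x₀ + ε), score ν μ aStar n a z = ((ℓ : ℝ) : EReal)} ⊆ S := by
      rintro z ⟨ℓ, hℓ, hz⟩
      rw [hS, mem_ofPred_eq, hz]
      exact_mod_cast (mem_Iio.1 hℓ).le
    refine (measure_mono hsub).trans ?_
    rw [← ofReal_measureReal]
    refine ENNReal.ofReal_le_ofReal (hP.trans ?_)
    rw [show -((n : ℝ) * (-x₀ - ε)) = n * (x₀ + ε) by ring]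
    exact mul_le_of_le_one_right (Real.exp_pos _).le measureReal_le_one
  have hlim : Tendsto (fun ε : ℝ => ENNReal.ofReal (-x₀ - ε)) (𝓝[>] 0)
      (𝓝 (ENNReal.ofReal (-x₀ - 0))) :=
    ((ENNReal.continuous_ofReal.comp (by fun_prop)).tendsto (0 : ℝ)).mono_left nhdsWithin_le_nhds
  rw [sub_zero] at hlim
  exact le_of_tendsto hlim (eventually_mem_nhdsWithin.mono fun ε h => hε ε h)

end Rate

theorem convergesAtRate_of_sandwich {C : ℕ → EReal} {C₀ ρ : ℝ}
    (hlow : ∀ ε > 0, ∀ᶠ n : ℕ in atTop, ((C₀ + Real.exp (-((ρ + ε) * n)) : ℝ) : EReal) ≤ C n)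
    (hup : ∀ ε > 0, ∀ᶠ n : ℕ in atTop, C n ≤ ((C₀ + Real.exp (-((ρ - ε) * n)) : ℝ) : EReal)) :
    ConvergesAtRate C C₀ ρ := by
  -- The remainder is forced; the sandwich makes `C n` finite and `C n - C₀` positive, so the
  -- logarithm is genuine for large `n`.
  refine ⟨fun n => Real.log ((C n).toReal - C₀) + ρ * n, ?_, ?_⟩
  · rw [Asymptotics.isLittleO_iff]
    intro ε hε
    filter_upwards [hlow ε hε, hup ε hε] with n h1 h2
    obtain ⟨x, ⟨hx1, hx2⟩, hx⟩ := exists_real_of_mem_Icc h1 h2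
    have hpos : 0 < x - C₀ := by linarith [Real.exp_pos (-((ρ + ε) * n))]
    have hl1 := Real.log_le_log (Real.exp_pos _)
      (show Real.exp (-((ρ + ε) * n)) ≤ x - C₀ by linarith)
    have hl2 := Real.log_le_log hpos (show x - C₀ ≤ Real.exp (-((ρ - ε) * n)) by linarith)
    rw [Real.log_exp] at hl1 hl2
    rw [hx, EReal.toReal_coe, Real.norm_eq_abs, Real.norm_eq_abs, Nat.abs_cast, abs_le]
    constructor <;> linarith
  · filter_upwards [hlow 1 one_pos, hup 1 one_pos] with n h1 h2
    obtain ⟨x, ⟨hx1, hx2⟩, hx⟩ := exists_real_of_mem_Icc h1 h2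
    have hpos : 0 < x - C₀ := by linarith [Real.exp_pos (-((ρ + 1) * n))]
    rw [hx, EReal.toReal_coe, show -ρ * n + (Real.log (x - C₀) + ρ * n) = Real.log (x - C₀) by ring,
      Real.exp_log hpos, add_sub_cancel]

end Monitoring

/-! ### Cost bounds for a single technology, with constants depending only on the payoffs. -/

namespace Monitoring

theorem exists_pos_le_of_finite {A : Type*} [Finite A] [Nonempty A] {f : A → ℝ}
    (hf : ∀ a, 0 < f a) : ∃ m > 0, ∀ a, m ≤ f a := by
  obtain ⟨a, ha⟩ := Finite.exists_min f
  exact ⟨f a, hf a, ha⟩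

open Classical in
theorem integrable_piecewise_const {Z : Type*} [MeasurableSpace Z] {P : Measure Z}
    [IsProbabilityMeasure P] {S : Set Z} (hS : MeasurableSet S) (f : ℝ → ℝ) (x y : ℝ) :
    Integrable (fun z => f (S.piecewise (fun _ => x) (fun _ => y) z)) P ∧
      ∫ z, f (S.piecewise (fun _ => x) (fun _ => y) z) ∂P
        = P.real S * f x + (1 - P.real S) * f y := by
  have heq : (fun z => f (S.piecewise (fun _ => x) (fun _ => y) z)) =
      fun z => S.indicator (fun _ => f x - f y) z + f y := by
    ext z
    by_cases hz : z ∈ S <;> simp [hz]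
  have hi : Integrable (S.indicator fun _ => f x - f y) P := (integrable_const _).indicator hS
  refine heq ▸ ⟨hi.add (integrable_const _), ?_⟩
  rw [integral_add hi (integrable_const _), integral_indicator_const _ hS]
  simp
  ring

section OneShot

variable {A Z : Type*} [MeasurableSpace Z] {w₀ : ℝ} {u : ℝ → ℝ} {c : A → ℝ} {aStar : A}

/-- If `aStar` yields utility at least `c aStar + δ / 2`, the tangent bound alone makes the contract
expensive, and `B` is everything. Otherwise incentive compatibility keeps utility under `a` at most
`c aStar - δ / 2`. Wages above `v` give at least `c aStar - δ / 4`, so wages up to `v` must have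
mass at least `δ / 4 / D` under `a`, and each of them incurs the tangent gap. -/
theorem exists_low_wage_event (hpay : PayoffAssumptions w₀ u c aStar) {w : ℝ} (hw : w₀ < w)
    (hu : u w = c aStar) {a : A} (ha : c a < c aStar) :
    ∃ κ > 0, ∃ γ > 0, ∀ P : A → Measure Z, (∀ a, IsProbabilityMeasure (P a)) →
      ∀ x : Z → ℝ, IsFeasible P w₀ u c aStar x → ∃ B, MeasurableSet B ∧ κ ≤ (P a).real B ∧
        w + γ * (P aStar).real B ≤ ∫ z, x z ∂(P aStar) := by
  set δ := c aStar - c a with hδ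
  have hδ0 : 0 < δ := sub_pos.2 ha
  have hlow := hpay.utility_lower_bound_lt a
  obtain ⟨v, hv, huv⟩ := intermediate_value_Icc hw.le
    (hpay.contDiffOn.continuousOn.mono Icc_subset_Ici_self)
    (show c aStar - δ / 4 ∈ Icc (u w₀) (u w) from ⟨by linarith, by linarith⟩)
  have hvw : v < w := (hpay.strictMonoOn.lt_iff_lt hv.1 hw.le).1 (by linarith)
  obtain ⟨s, hs, γ₀, hγ₀, htan, hgap⟩ := hpay.exists_tangent_gap hv.1 hvw
  set D := c aStar - δ / 4 - u w₀ with hD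
  have hD0 : 0 < D := by linarith
  refine ⟨min 1 (δ / 4 / D), by positivity, min (γ₀ / s) (δ / 2 / s), by positivity,
    fun P hP x hx => ?_⟩
  have hIR := hx.individually_rational
  have hIC := hx.incentive_compatible a
  have hxi := hx.integrable_wage
  have hui := hx.integrable_utility
  have hsub : Integrable (fun z => s * (x z - w)) (P aStar) :=
    (hxi.sub (integrable_const w)).const_mul s
  have hlin : Integrable (fun z => u w + s * (x z - w)) (P aStar) :=
    (integrable_const _).add hsub
  have hlin_eq : ∫ z, (u w + s * (x z - w)) ∂(P aStar) =
      c aStar + s * ((∫ z, x z ∂(P aStar)) - w) := by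
    rw [integral_add (integrable_const _) hsub,
      integral_const_mul, integral_sub hxi (integrable_const _)]
    simp [hu]
  rcases le_total (c aStar + δ / 2) (∫ z, u (x z) ∂(P aStar)) with hbig | hsmall
  · refine ⟨univ, MeasurableSet.univ, by simp, ?_⟩
    have h1 : ∫ z, u (x z) ∂(P aStar) ≤ ∫ z, (u w + s * (x z - w)) ∂(P aStar) :=
      integral_mono (hui aStar) hlin fun z => htan _ (hx.lower_bound z)
    rw [hlin_eq] at h1
    have h2 : δ / 2 / s ≤ (∫ z, x z ∂(P aStar)) - w := by
      rw [div_le_iff₀ hs]; linarith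
    have h3 := min_le_right (γ₀ / s) (δ / 2 / s)
    rw [probReal_univ, mul_one]
    linarith
  · have hB : MeasurableSet {z | x z ≤ v} := measurableSet_le hx.measurable measurable_const
    refine ⟨{z | x z ≤ v}, hB, (min_le_right _ _).trans ?_, ?_⟩
    · have hi : Integrable ({z | x z ≤ v}.indicator fun _ => D) (P a) :=
        (integrable_const _).indicator hB
      have h1 : ∫ z, ((c aStar - δ / 4) - {z | x z ≤ v}.indicator (fun _ => D) z) ∂(P a) ≤
          ∫ z, u (x z) ∂(P a) := by
        refine integral_mono ((integrable_const _).sub hi) (hui a) fun z => ?_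
        by_cases hz : x z ≤ v
        · have := hpay.strictMonoOn.monotoneOn self_mem_Ici (hx.lower_bound z) (hx.lower_bound z)
          simp only [indicator, mem_ofPred_eq, hz, if_true]
          linarith
        · have := hpay.strictMonoOn.monotoneOn hv.1 (hx.lower_bound z) (not_le.1 hz).le
          simp only [indicator, mem_ofPred_eq, hz, if_false]
          linarith
      rw [integral_sub (integrable_const _) hi, integral_indicator_const _ hB, integral_const,
        probReal_univ, one_smul, smul_eq_mul] at h1
      rw [div_le_iff₀ hD0]
      linarith
    · have hi : Integrable ({z | x z ≤ v}.indicator fun _ => γ₀) (P aStar) :=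
        (integrable_const _).indicator hB
      have h1 : ∫ z, (u (x z) + {z | x z ≤ v}.indicator (fun _ => γ₀) z) ∂(P aStar) ≤
          ∫ z, (u w + s * (x z - w)) ∂(P aStar) := by
        refine integral_mono ((hui aStar).add hi) hlin fun z => ?_
        by_cases hz : x z ≤ v
        · simpa [indicator, hz] using hgap _ (hx.lower_bound z) hz
        · simpa [indicator, hz] using htan _ (hx.lower_bound z)
      rw [hlin_eq, integral_add (hui aStar) hi, integral_indicator_const _ hB, smul_eq_mul] at h1
      have h2 : γ₀ / s * (P aStar).real {z | x z ≤ v} ≤ (∫ z, x z ∂(P aStar)) - w := by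
        rw [div_mul_eq_mul_div, div_le_iff₀ hs]; linarith
      have h3 := mul_le_mul_of_nonneg_right (min_le_left (γ₀ / s) (δ / 2 / s))
        (measureReal_nonneg (μ := P aStar) (s := {z | x z ≤ v}))
      linarith

/-- Pay `w₀` on `S` and `y` off it, with `y` making participation bind. Cheaper actions are almost
surely punished and end near `u w₀`, below their cost; costlier ones gain at most the small bonus
`e`. -/
theorem exists_binaryCost_le [Finite A] (hpay : PayoffAssumptions w₀ u c aStar) {w : ℝ}
    (hw : w₀ < w) (hu : u w = c aStar) :
    ∃ K > 0, ∃ p₀ > 0, ∃ η > 0, ∀ P : A → Measure Z, (∀ a, IsProbabilityMeasure (P a)) →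
      ∀ S : Set Z, MeasurableSet S → (P aStar).real S ≤ p₀ →
        (∀ a, c a < c aStar → (P a).real Sᶜ ≤ η) →
        binaryCost P w₀ u c aStar ≤ ((w + K * (P aStar).real S : ℝ) : EReal) := by
  classical
  have : Nonempty A := ⟨aStar⟩
  obtain ⟨K, hK, δ, hδ, hinv⟩ := hpay.exists_lipschitz_inverse hw
  obtain ⟨m₁, hm₁, hm₁'⟩ := exists_pos_le_of_finite (f := fun a => c a - u w₀)
    fun a => sub_pos.2 (hpay.utility_lower_bound_lt a)
  -- The value 1 is a filler keeping the minimum positive at actions that are not costlier.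
  obtain ⟨m₂, hm₂, hm₂'⟩ := exists_pos_le_of_finite
    (f := fun a => if c aStar < c a then c a - c aStar else 1)
    fun a => by split_ifs with h; exacts [sub_pos.2 h, one_pos]
  set D := c aStar - u w₀ with hD
  have hD0 : 0 < D := sub_pos.2 (hpay.utility_lower_bound_lt aStar)
  -- The bounds on `p` ensure in turn `e ≤ 2 * D * p`, that `e` stays in the range of the local
  -- inverse, and that costlier deviations do not pay. In the bound on `P a Sᶜ`, 1/2 makes `S`
  -- nonempty and `m₁` handles cheaper deviations.
  refine ⟨K * (2 * D), by positivity, min (1 / 2) (min (δ / (2 * D)) (m₂ / (2 * D))),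
    by positivity, min (1 / 2) (m₁ / (2 * D)), by positivity, fun P hP S hS hp hq => ?_⟩
  set p := (P aStar).real S with hpdef
  have hp0 : 0 ≤ p := measureReal_nonneg
  have hp1 : p ≤ 1 / 2 := hp.trans (min_le_left _ _)
  have hp2 : p * (2 * D) ≤ δ := by
    rw [← le_div_iff₀ (by positivity)]
    exact hp.trans ((min_le_right _ _).trans (min_le_left _ _))
  have hp3 : p * (2 * D) ≤ m₂ := by
    rw [← le_div_iff₀ (by positivity)]
    exact hp.trans ((min_le_right _ _).trans (min_le_right _ _))
  -- The bonus solves `e * (1 - p) = D * p`, offsetting the expected punishment under `aStar`.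
  set e := D * p / (1 - p) with he
  have he0 : 0 ≤ e := div_nonneg (by positivity) (by linarith)
  have he1 : e ≤ p * (2 * D) := by
    rw [he, div_le_iff₀ (by linarith)]
    nlinarith [mul_nonneg (mul_nonneg hD0.le hp0) (show 0 ≤ 1 - 2 * p by linarith)]
  have heD : e ≤ D := by nlinarith
  have hep : e * (1 - p) = D * p := div_mul_cancel₀ _ (by linarith)
  obtain ⟨y, hy, huy, hyK⟩ := hinv (u w + e) ⟨by linarith, by linarith⟩
  have hy0 : w₀ < y := hw.trans_le hy
  rw [hu] at huy
  set x : Z → ℝ := S.piecewise (fun _ => w₀) (fun _ => y) with hx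
  have hint : ∀ (a : A) (f : ℝ → ℝ), Integrable (fun z => f (x z)) (P a) ∧
      ∫ z, f (x z) ∂(P a) = (P a).real S * f w₀ + (1 - (P a).real S) * f y :=
    fun a f => integrable_piecewise_const hS f w₀ y
  have hbind : ∫ z, u (x z) ∂(P aStar) = c aStar := by
    rw [(hint aStar u).2, ← hpdef, huy]
    nlinarith
  have hfeas : IsFeasible P w₀ u c aStar x := by
    refine ⟨measurable_const.piecewise hS measurable_const, fun z => ?_, (hint aStar id).1,
      fun a => (hint a u).1, fun a => ?_, by rw [hbind, sub_self]⟩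
    · by_cases hz : z ∈ S <;> simp [hx, hz, hy0.le]
    · rcases eq_or_ne a aStar with rfl | hne
      · exact le_rfl
      rw [hbind, (hint a u).2, huy, sub_self]
      have hq0 : 0 ≤ (P a).real S := measureReal_nonneg
      have hq1 : (P a).real S ≤ 1 := measureReal_le_one
      rcases (hpay.cost_ne a hne).lt_or_gt with hlt | hlt
      · have h1 := hq a hlt
        rw [probReal_compl_eq_one_sub hS] at h1
        have h2 : (1 - (P a).real S) * (2 * D) ≤ m₁ := by
          rw [← le_div_iff₀ (by positivity)]
          exact h1.trans (min_le_right _ _)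
        have h3 := hm₁' a
        have h4 : (1 - (P a).real S) * (D + e) ≤ (1 - (P a).real S) * (2 * D) :=
          mul_le_mul_of_nonneg_left (by linarith) (by linarith)
        have h5 : (P a).real S * u w₀ + (1 - (P a).real S) * (c aStar + e) =
          u w₀ + (1 - (P a).real S) * (D + e) := by rw [hD]; ring
        linarith
      · have h1 := hm₂' a
        simp only [hlt, if_true] at h1
        have h2 := hpay.utility_lower_bound_lt aStar
        nlinarith [mul_nonneg hq0 (show 0 ≤ c aStar + e - u w₀ by linarith)]
  have hbin : IsBinary x := by
    obtain ⟨a, ha⟩ := hpay.exists_cheaper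
    have hne : S.Nonempty := by
      rw [nonempty_iff_ne_empty]
      rintro rfl
      have := (hq a ha).trans (min_le_left _ _)
      norm_num at this
    have hcne : Sᶜ.Nonempty := by
      rw [nonempty_compl]
      rintro rfl
      rw [hpdef, probReal_univ] at hp1
      norm_num at hp1
    rw [IsBinary, hx, range_piecewise, hne.image_const, hcne.image_const]
    exact ncard_pair hy0.ne
  refine (iInf₂_le x ⟨hfeas, hbin⟩).trans (EReal.coe_le_coe_iff.2 ?_)
  have := (hint aStar id).2
  simp only [id] at this
  rw [this, ← hpdef]
  have h1 : K * e ≤ K * (p * (2 * D)) := mul_le_mul_of_nonneg_left he1 hK.le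
  have h2 : p * w₀ ≤ p * y := mul_le_mul_of_nonneg_left hy0.le hp0
  rw [add_sub_cancel_left] at hyK
  nlinarith

end OneShot

end Monitoring

/-! ### Asymptotic cost bounds. -/

namespace Monitoring

theorem eventually_mul_exp_le {k ρ ε : ℝ} (hk : 0 < k) (hε : 0 < ε) :
    ∀ᶠ n : ℕ in atTop, k * Real.exp (-((ρ + ε) * n)) ≤ Real.exp (-(ρ * n)) := by
  filter_upwards [eventually_exp_neg_mul_le hε (inv_pos.2 hk)] with n hn
  rw [show -((ρ + ε) * n) = -(ρ * n) + -(n * ε) by ring, Real.exp_add, mul_left_comm]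
  refine mul_le_of_le_one_right (Real.exp_pos _).le ?_
  calc k * Real.exp (-(n * ε)) ≤ k * k⁻¹ := mul_le_mul_of_nonneg_left hn hk.le
    _ = 1 := mul_inv_cancel₀ hk.ne'

section Asymptotics

variable {A Z : Type*} [MeasurableSpace Z] {ν : Measure Z} [SigmaFinite ν] {μ : ℕ → A → Measure Z}
  [∀ n a, IsProbabilityMeasure (μ n a)] {w₀ : ℝ} {u : ℝ → ℝ} {c : A → ℝ} {aStar : A}

/-- The low-wage event keeps mass `κ / 2` under `a` after intersection with the concentration
window, where the likelihood ratio is at least `exp (n * (x₀ - ε / 2))`. The other `ε / 2` absorbs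
the constants. -/
theorem eventually_le_secondBestCost (hpay : PayoffAssumptions w₀ u c aStar)
    (hac : ∀ n a, μ n a ≪ ν) {a : A} (ha : c a < c aStar) {x₀ : ℝ}
    (hconc : ∀ ε > 0, ∀ η > 0, ∀ᶠ n : ℕ in atTop, (μ n a).real
      {z | ((x₀ - ε : ℝ) : EReal) ≤ score ν μ aStar n a z ∧
        score ν μ aStar n a z ≤ ((x₀ + ε : ℝ) : EReal)}ᶜ ≤ η) {ε : ℝ} (hε : 0 < ε) :
    ∀ᶠ n : ℕ in atTop,
      ((firstBestCost w₀ u c aStar + Real.exp (-((-x₀ + ε) * n)) : ℝ) : EReal) ≤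
        secondBestCost (μ n) w₀ u c aStar := by
  obtain ⟨w, hw, hu⟩ := hpay.exists_wage
  rw [hpay.firstBestCost_eq hw hu]
  obtain ⟨κ, hκ, γ, hγ, hcon⟩ := exists_low_wage_event (Z := Z) hpay hw hu ha
  filter_upwards [hconc (ε / 2) (half_pos hε) (κ / 2) (half_pos hκ), eventually_ge_atTop 1,
    eventually_mul_exp_le (k := (γ * (κ / 2))⁻¹) (ρ := -x₀ + ε / 2) (by positivity) (half_pos hε)]
    with n hn hn1 hexp
  refine le_iInf₂ fun x hx => EReal.coe_le_coe_iff.2 ?_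
  obtain ⟨B, hB, hκB, hcost⟩ := hcon (μ n) inferInstance x hx
  set S := {z | ((x₀ - ε / 2 : ℝ) : EReal) ≤ score ν μ aStar n a z ∧
        score ν μ aStar n a z ≤ ((x₀ + ε / 2 : ℝ) : EReal)} with hS
  have hSm : MeasurableSet S :=
    (measurableSet_le measurable_const (measurable_score n a)).inter
      (measurableSet_le (measurable_score n a) measurable_const)
  have h1 : κ / 2 ≤ (μ n a).real (B ∩ S) := by
    have h2 : (μ n a).real B ≤ (μ n a).real (B ∩ S) + (μ n a).real Sᶜ := by
      refine (measureReal_mono (s₂ := (B ∩ S) ∪ Sᶜ) fun z hz => ?_).trans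
        (measureReal_union_le _ _)
      by_cases hzS : z ∈ S
      exacts [Or.inl ⟨hz, hzS⟩, Or.inr hzS]
    linarith
  have h3 := le_measure_of_le_score hac hn1 a (hB.inter hSm) (t := x₀ - ε / 2)
    fun z hz => hz.2.1
  have h4 : (μ n aStar).real (B ∩ S) ≤ (μ n aStar).real B := measureReal_mono inter_subset_left
  have h5 : Real.exp (n * (x₀ - ε / 2)) * (κ / 2) ≤ (μ n aStar).real B :=
    (mul_le_mul_of_nonneg_left h1 (Real.exp_pos _).le).trans (h3.trans h4)
  have h6 := mul_le_mul_of_nonneg_left h5 hγ.le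
  rw [inv_mul_le_iff₀ (by positivity)] at hexp
  rw [show -((-x₀ + ε / 2 + ε / 2) * n) = -((-x₀ + ε) * (n : ℝ)) by ring,
    show -((-x₀ + ε / 2) * n) = (n : ℝ) * (x₀ - ε / 2) by ring] at hexp
  linarith

theorem eventually_binaryCost_le [Finite A] (hpay : PayoffAssumptions w₀ u c aStar)
    (hac : ∀ n a, μ n a ≪ ν) {Lhat : A → ℝ} {ρ : ℝ} (hρ : 0 < ρ)
    (hLhat : ∀ a, c a < c aStar → Lhat a ≤ -ρ)
    (hconc : ∀ a, c a < c aStar → ∀ ε > 0, ∀ η > 0, ∀ᶠ n : ℕ in atTop, (μ n a).real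
      {z | ((Lhat a - ε : ℝ) : EReal) ≤ score ν μ aStar n a z ∧
        score ν μ aStar n a z ≤ ((Lhat a + ε : ℝ) : EReal)}ᶜ ≤ η) {ε : ℝ} (hε : 0 < ε) :
    ∀ᶠ n : ℕ in atTop, binaryCost (μ n) w₀ u c aStar ≤
      ((firstBestCost w₀ u c aStar + Real.exp (-((ρ - ε) * n)) : ℝ) : EReal) := by
  classical
  have := Fintype.ofFinite A
  obtain ⟨w, hw, hu⟩ := hpay.exists_wage
  rw [hpay.firstBestCost_eq hw hu]
  obtain ⟨K, hK, p₀, hp₀, η, hη, hcost⟩ := exists_binaryCost_le (Z := Z) hpay hw hu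
  -- Capping by `ρ` keeps `ρ - ε' / 2` positive, so the punishment probability under `aStar` tends
  -- to 0.
  set ε' := min ε ρ with hε'
  have hε'0 : 0 < ε' := lt_min hε hρ
  have hρ' : 0 < ρ - ε' / 2 := by linarith [min_le_right ε ρ]
  set T := Finset.univ.filter fun a => c a < c aStar with hT
  have hTpos : (0 : ℝ) < T.card := by
    obtain ⟨a, ha⟩ := hpay.exists_cheaper
    exact_mod_cast Finset.card_pos.2 ⟨a, by simpa [hT] using ha⟩
  have hall : ∀ᶠ n : ℕ in atTop, ∀ a, c a < c aStar → (μ n a).real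
      {z | ((Lhat a - ε' / 2 : ℝ) : EReal) ≤ score ν μ aStar n a z ∧
        score ν μ aStar n a z ≤ ((Lhat a + ε' / 2 : ℝ) : EReal)}ᶜ ≤ η := by
    refine eventually_all.2 fun a => ?_
    by_cases ha : c a < c aStar
    · exact (hconc a ha _ (half_pos hε'0) η hη).mono fun n hn _ => hn
    · exact Eventually.of_forall fun n h => absurd h ha
  filter_upwards [hall, eventually_ge_atTop 1,
    eventually_exp_neg_mul_le hρ' (div_pos hp₀ hTpos),
    eventually_mul_exp_le (k := K * T.card) (ρ := ρ - ε') (by positivity) (half_pos hε'0)]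
    with n hn hn1 hsmall hexp
  -- One punishment event serves against all cheaper actions; the union bound costs only the factor
  -- `T.card`.
  set S := ⋃ a ∈ T, {z | score ν μ aStar n a z ≤ ((Lhat a + ε' / 2 : ℝ) : EReal)} with hS
  have hm : ∀ a, MeasurableSet {z | score ν μ aStar n a z ≤ ((Lhat a + ε' / 2 : ℝ) : EReal)} :=
    fun a => measurableSet_le (measurable_score n a) measurable_const
  have hSm : MeasurableSet S := T.measurableSet_biUnion fun a _ => hm a
  have hPS : (μ n aStar).real S ≤ T.card * Real.exp (-(n * (ρ - ε' / 2))) := by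
    refine (measureReal_biUnion_finset_le T _).trans ?_
    rw [← nsmul_eq_mul]
    refine Finset.sum_le_card_nsmul _ _ _ fun a ha => ?_
    have hca : c a < c aStar := by simpa [hT] using ha
    refine (measure_le_of_score_le hac hn1 a (hm a) fun z hz => hz).trans
      ((mul_le_of_le_one_right (Real.exp_pos _).le measureReal_le_one).trans
        (Real.exp_le_exp.2 ?_))
    rw [← mul_neg]
    exact mul_le_mul_of_nonneg_left (by linarith [hLhat a hca]) (Nat.cast_nonneg n)
  have hPS' : (μ n aStar).real S ≤ p₀ := by
    rw [le_div_iff₀ hTpos] at hsmall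
    linarith
  refine (hcost (μ n) inferInstance S hSm hPS' fun a ha => ?_).trans (EReal.coe_le_coe_iff.2 ?_)
  · refine (measureReal_mono (compl_subset_compl.2 fun z hz => ?_)).trans (hn a ha)
    exact mem_biUnion (show a ∈ T by simpa [hT] using ha) hz.2
  · have h1 := mul_le_mul_of_nonneg_left hPS hK.le
    rw [show -((n : ℝ) * (ρ - ε' / 2)) = -((ρ - ε' + ε' / 2) * n) by ring] at h1
    have h2 : Real.exp (-((ρ - ε') * n)) ≤ Real.exp (-((ρ - ε) * n)) := by
      refine Real.exp_le_exp.2 (neg_le_neg (mul_le_mul_of_nonneg_right ?_ (Nat.cast_nonneg n)))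
      linarith [min_le_left ε ρ]
    linarith

theorem secondBestCost_le_binaryCost (P : A → Measure Z) :
    secondBestCost P w₀ u c aStar ≤ binaryCost P w₀ u c aStar :=
  le_iInf₂ fun x hx => iInf₂_le x hx.1

end Asymptotics

end Monitoring

/-! ### The theorem. -/

theorem theorem3 {A Z : Type*} [Finite A] [MeasurableSpace Z]
    -- payoffs
    (w₀ : ℝ) (u : ℝ → ℝ) (c : A → ℝ) (aStar : A)
    (hpay : Monitoring.PayoffAssumptions w₀ u c aStar)
    -- a sequence of monitoring technologies
    (ν : Measure Z) [SigmaFinite ν]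
    (μ : ℕ → A → Measure Z) [∀ n a, IsProbabilityMeasure (μ n a)]
    (hac : ∀ n a, μ n a ≪ ν)
    (hscore : Monitoring.ScoresWellDefined ν μ aStar)
    -- large-deviation principle under every chosen action, for every score
    (I : A → A → ℝ → ℝ≥0∞)
    (hldp : ∀ a a' : A, a' ≠ aStar →
      Monitoring.LargeDeviationPrinciple (fun n => μ n a)
        (fun n => Monitoring.score ν μ aStar n a') (I a a'))
    -- identification
    (Lhat : A → A → ℝ)
    (hmin : ∀ a a' : A, a' ≠ aStar → ∀ ℓ : ℝ, ℓ ≠ Lhat a a' → I a a' (Lhat a a') < I a a' ℓ)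
    (hident : ∀ a b a' : A, a' ≠ aStar → a ≠ b → Lhat a a' ≠ Lhat b a')
    -- regularity
    (hcompact : ∀ a a' : A, a' ≠ aStar → ∀ k : ℝ≥0, IsCompact {ℓ : ℝ | I a a' ℓ ≤ k})
    (hcont : ∀ a' : A, a' ≠ aStar → ContinuousAt (I aStar a') (Lhat a' a') ∧
      ContinuousAt (I aStar a') (Lhat aStar a')) :
    0 < Monitoring.rate c aStar I Lhat ∧ Monitoring.rate c aStar I Lhat ≠ ⊤ ∧
    Monitoring.ConvergesAtRate
      (fun n => Monitoring.secondBestCost (μ n) w₀ u c aStar)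
      (Monitoring.firstBestCost w₀ u c aStar) (Monitoring.rate c aStar I Lhat).toReal ∧
    Monitoring.ConvergesAtRate
      (fun n => Monitoring.binaryCost (μ n) w₀ u c aStar)
      (Monitoring.firstBestCost w₀ u c aStar) (Monitoring.rate c aStar I Lhat).toReal := by
  have hne : ∀ {a}, c a < c aStar → a ≠ aStar := fun h he => h.ne (congrArg c he)
  have hconc : ∀ a, c a < c aStar → ∀ ε > 0, ∀ η > 0, ∀ᶠ n : ℕ in atTop, (μ n a).real
      {z | ((Lhat a a - ε : ℝ) : EReal) ≤ Monitoring.score ν μ aStar n a z ∧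
        Monitoring.score ν μ aStar n a z ≤ ((Lhat a a + ε : ℝ) : EReal)}ᶜ ≤ η :=
    fun a ha ε hε η hη => (hldp a a (hne ha)).eventually_concentrated
      (fun n hn => Monitoring.ae_score_real hac hscore hn (hne ha) (hne ha))
      (hcompact a a (hne ha)) (hmin a a (hne ha)) hε hη
  have hrate : ∀ a, c a < c aStar → I aStar a (Lhat a a) = ENNReal.ofReal (-Lhat a a) :=
    fun a ha => le_antisymm
      (Monitoring.rate_le_neg_of_concentrated hac (hldp aStar a (hne ha)) (hconc a ha)
        (hcont a (hne ha)).1)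
      (Monitoring.neg_le_rate hac (hldp aStar a (hne ha)) _)
  -- By identification `Lhat a a` is not the minimizer of `I aStar a`, so the rate there is
  -- positive.
  have hneg : ∀ a, c a < c aStar → 0 < -Lhat a a := fun a ha => by
    have := (zero_le).trans_lt (hmin aStar a (hne ha) (Lhat a a)
      (hident a aStar a (hne ha) (hne ha)))
    rwa [hrate a ha, ENNReal.ofReal_pos] at this
  obtain ⟨a₀, ha₀, hmin₀⟩ := Set.exists_min_image {a | c a < c aStar} (fun a => -Lhat a a)
    (Set.toFinite _) hpay.exists_cheaper
  have hρ : Monitoring.rate c aStar I Lhat = ENNReal.ofReal (-Lhat a₀ a₀) := by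
    refine le_antisymm ((iInf₂_le a₀ ha₀).trans (hrate a₀ ha₀).le) (le_iInf₂ fun a ha => ?_)
    rw [hrate a ha]
    exact ENNReal.ofReal_le_ofReal (hmin₀ a ha)
  have hpos := hneg a₀ ha₀
  rw [hρ, ENNReal.toReal_ofReal hpos.le]
  -- The lower bound uses only the worst action `a₀`; the upper bound must deter all cheaper ones.
  have hlow := fun ε (hε : 0 < ε) =>
    Monitoring.eventually_le_secondBestCost hpay hac ha₀ (hconc a₀ ha₀) hε
  have hup := fun ε (hε : 0 < ε) =>
    Monitoring.eventually_binaryCost_le hpay hac (Lhat := fun a => Lhat a a) hpos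
      (fun a ha => le_neg.1 (hmin₀ a ha)) hconc hε
  refine ⟨ENNReal.ofReal_pos.2 hpos, ENNReal.ofReal_ne_top,
    Monitoring.convergesAtRate_of_sandwich hlow fun ε hε => (hup ε hε).mono fun n hn =>
      (Monitoring.secondBestCost_le_binaryCost _).trans hn,
    Monitoring.convergesAtRate_of_sandwich (fun ε hε => (hlow ε hε).mono fun n hn =>
      hn.trans (Monitoring.secondBestCost_le_binaryCost _)) hup⟩
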